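/- Lemma 2.2 (generalized Young inequality). For a measurable function $f$ on $\mathbb{R}^n$ let $f_*(\alpha)=|\{x:|f(x)|>\alpha\}|$ be its distribution function and $f^*(t)=\inf\{\alpha>0: f_*(\alpha)\le t\}$ its decreasing rearrangement. For $p,q\in(0,\infty]$ put $$\|f\|_{L^{p,q}(\mathbb{R}^n)}=\Big(\int_0^\infty \big(t^{1/p}f^*(t)\big)^q\,\frac{dt}{t}\Big)^{1/q}\ \text{ if } q<\infty,\qquad \|f\|_{L^{p,\infty}(\mathbb{R}^n)}=\sup_{t>0}t^{1/p}f^*(t),$$ and let $L^{p,q}(\mathbb{R}^n)$ be the set of measurable functions $f$ with $\|f\|_{L^{p,q}(\mathbb{R}^n)}<\infty$. Suppose that $0<l\le s\le\infty$, $1\le r<\infty$, $1<p,q<\infty$ and $$\frac1p+1=\frac1q+\frac1r.$$ Then there exists a constant $C>0$ depending only on $r,q,s$ and $l$ such that for every $n$ and all real- or complex-valued $f\in L^{q,l}(\mathbb{R}^n)$ and $g\in L^r(\mathbb{R}^n)$, the convolution integral $(f*g)(x)=\int_{\mathbb{R}^n} f(y)g(x-y)\,dy$ converges absolutely for almost every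 $x$, $f*g\in L^{p,s}(\mathbb{R}^n)$, and $$\|f*g\|_{L^{p,s}(\mathbb{R}^n)}\le C\,\|f\|_{L^{q,l}(\mathbb{R}^n)}\,\|g\|_{L^r(\mathbb{R}^n)}.$$ -/

import Mathlib

open MeasureTheory
open scoped ENNReal NNReal Convolution

/-- The distribution function `f_*(a) = μ {x : |f x| > a}`. -/
noncomputable def distributionFunction {α E : Type*} [MeasurableSpace α] [NormedAddCommGroup E]
    (f : α → E) (μ : Measure α) (a : ℝ≥0∞) : ℝ≥0∞ :=
  μ {x | a < ‖f x‖ₑ}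

/-- The decreasing rearrangement `f^*(t) = inf {a > 0 : f_*(a) ≤ t}`, with values in `[0, ∞]`
(it is `∞` when no finite `a` satisfies the condition). -/
noncomputable def decreasingRearrangement {α E : Type*} [MeasurableSpace α]
    [NormedAddCommGroup E] (f : α → E) (μ : Measure α) (t : ℝ≥0∞) : ℝ≥0∞ :=
  sInf {a : ℝ≥0∞ | 0 < a ∧ distributionFunction f μ a ≤ t}

/-- The Lorentz (quasi-)norm `‖f‖_{L^{p,q}}` for `p, q ∈ (0, ∞]`: it is
`(∫₀^∞ (t^{1/p} f^*(t))^q dt/t)^{1/q}` if `q < ∞`, and `sup_{t > 0} t^{1/p} f^*(t)` if `q = ∞`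
(where `1/p = 0` for `p = ∞`). -/
noncomputable def lorentzNorm {α E : Type*} [MeasurableSpace α] [NormedAddCommGroup E]
    (f : α → E) (p q : ℝ≥0∞) (μ : Measure α) : ℝ≥0∞ :=
  if q = ∞ then
    ⨆ t ∈ Set.Ioi (0 : ℝ),
      ENNReal.ofReal t ^ (p⁻¹).toReal * decreasingRearrangement f μ (ENNReal.ofReal t)
  else
    (∫⁻ t in Set.Ioi (0 : ℝ),
      (ENNReal.ofReal t ^ (p⁻¹).toReal * decreasingRearrangement f μ (ENNReal.ofReal t))
        ^ q.toReal / ENNReal.ofReal t) ^ (1 / q.toReal)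

/-- Membership in the Lorentz space `L^{p,q}`: `f` is measurable (with respect to the completed
measure) and has finite Lorentz norm. -/
def MemLorentz {α E : Type*} [MeasurableSpace α] [NormedAddCommGroup E]
    (f : α → E) (p q : ℝ≥0∞) (μ : Measure α) : Prop :=
  AEStronglyMeasurable f μ ∧ lorentzNorm f p q μ < ∞

/-! Let u = |f|, w = |g| and h = u^*. Since |f * g| ≤ u * w pointwise, it suffices to bound the
rearrangement of u * w. For each τ, cut u at the height h(τ). The low part splits into layers
h(2^(k+1) τ) < u ≤ h(2^k τ) of measure at most 2^(k+1) τ; Hölder on each layer bounds its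
convolution uniformly in x. The L¹ norm of the high part is controlled by the same kind of layers at
scales 2^(-k) τ; Young L¹ * L^r ⊆ L^r and Chebyshev then bound its convolution outside a set of
measure τ. Together this is `rearrangement_conv_le`.

Multiplying by τ^(1/p) turns each term into t^(1/q) h(t) at a dyadic dilate t of τ, with a factor at
most 2 · 2^(-k/p) on the low side and 2 · 2^(-k(1-1/q)) on the high side. Both decay because p < ∞
and q > 1. Dilations preserve the norm of L^l(dt/t), so the series sums
(`exists_mellinNorm_tsum_dyadic_le`), giving a bound in L^{p,l}. The embedding L^{p,l} ⊆ L^{p,s}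
(`exists_mellinNorm_le_of_le`) concludes. -/

/-- The `L^s` norm of `φ` on `(0, ∞)` with respect to the dilation-invariant measure `dt / t`. -/
noncomputable def mellinNorm (φ : ℝ → ℝ≥0∞) (s : ℝ≥0∞) : ℝ≥0∞ :=
  if s = ∞ then ⨆ t ∈ Set.Ioi (0 : ℝ), φ t
  else (∫⁻ t in Set.Ioi (0 : ℝ), φ t ^ s.toReal / ENNReal.ofReal t) ^ (1 / s.toReal)

/-- The decreasing rearrangement of a function with values in `[0, ∞]`. -/
noncomputable def rearrangement {α : Type*} [MeasurableSpace α] (u : α → ℝ≥0∞) (μ : Measure α)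
    (t : ℝ≥0∞) : ℝ≥0∞ :=
  sInf {a : ℝ≥0∞ | 0 < a ∧ μ {x | a < u x} ≤ t}

/-- The function `t ↦ t ^ e * h t` on the real line. -/
noncomputable def powerWeighted (e : ℝ) (h : ℝ≥0∞ → ℝ≥0∞) (t : ℝ) : ℝ≥0∞ :=
  ENNReal.ofReal t ^ e * h (ENNReal.ofReal t)

/-! ### Norms with respect to dt/t and sums of dyadic dilates -/

theorem lorentzNorm_eq_mellinNorm {α E : Type*} [MeasurableSpace α] [NormedAddCommGroup E]
    (f : α → E) (p q : ℝ≥0∞) (μ : Measure α) :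
    lorentzNorm f p q μ =
      mellinNorm (powerWeighted (p⁻¹).toReal (rearrangement (fun x => ‖f x‖ₑ) μ)) q := rfl

theorem mellinNorm_mono {φ ψ : ℝ → ℝ≥0∞} (h : ∀ t, 0 < t → φ t ≤ ψ t) (s : ℝ≥0∞) :
    mellinNorm φ s ≤ mellinNorm ψ s := by
  unfold mellinNorm
  split_ifs
  · exact iSup₂_mono fun t ht => h t ht
  · refine ENNReal.rpow_le_rpow (setLIntegral_mono' measurableSet_Ioi fun t ht => ?_) (by positivity)
    exact ENNReal.div_le_div_right (ENNReal.rpow_le_rpow (h t ht) ENNReal.toReal_nonneg) _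

theorem mellinNorm_const_mul {φ : ℝ → ℝ≥0∞} (hφ : Measurable φ) (c : ℝ≥0∞) {s : ℝ≥0∞}
    (hs : s ≠ 0) : mellinNorm (fun t => c * φ t) s = c * mellinNorm φ s := by
  unfold mellinNorm
  split_ifs with h
  · simp_rw [ENNReal.mul_iSup]
  · have hs' : 0 < s.toReal := ENNReal.toReal_pos hs h
    simp_rw [ENNReal.mul_rpow_of_nonneg _ _ hs'.le, mul_div_assoc]
    rw [lintegral_const_mul _ (by fun_prop), ENNReal.mul_rpow_of_nonneg _ _ (by positivity),
      ← ENNReal.rpow_mul, mul_one_div_cancel hs'.ne', ENNReal.rpow_one]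

/-- dt/t is the Haar measure of the multiplicative group (0, ∞). -/
theorem lintegral_Ioi_comp_mul_div (F : ℝ → ℝ≥0∞) {c : ℝ} (hc : 0 < c) :
    ∫⁻ t in Set.Ioi (0 : ℝ), F (c * t) / ENNReal.ofReal t =
      ∫⁻ t in Set.Ioi (0 : ℝ), F t / ENNReal.ofReal t := by
  have him : (fun t : ℝ => c * t) '' Set.Ioi 0 = Set.Ioi 0 := by
    simp [Set.image_mul_left_Ioi hc]
  have key := lintegral_image_eq_lintegral_abs_deriv_mul (s := Set.Ioi (0 : ℝ))
    (f := fun t => c * t) (f' := fun _ => c) measurableSet_Ioi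
    (fun x _ => by simpa using ((hasDerivAt_id x).const_mul c).hasDerivWithinAt)
    (fun x _ y _ h => mul_left_cancel₀ hc.ne' h) (fun t => F t / ENNReal.ofReal t)
  rw [him] at key
  rw [key]
  refine setLIntegral_congr_fun measurableSet_Ioi fun t ht => ?_
  have h0 : ENNReal.ofReal c ≠ 0 := by simpa using hc
  simp only [abs_of_pos hc, ENNReal.ofReal_mul hc.le, div_eq_mul_inv]
  rw [ENNReal.mul_inv (Or.inl h0) (Or.inl ENNReal.ofReal_ne_top), mul_left_comm, ← mul_assoc
    (ENNReal.ofReal c), ENNReal.mul_inv_cancel h0 ENNReal.ofReal_ne_top, one_mul]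

theorem add_rpow_le_two_rpow_mul (x y : ℝ≥0∞) {l : ℝ} (hl : 0 ≤ l) :
    (x + y) ^ l ≤ 2 ^ l * (x ^ l + y ^ l) := by
  wlog h : x ≤ y generalizing x y
  · rw [add_comm x y, add_comm (x ^ l)]; exact this y x (le_of_not_ge h)
  calc (x + y) ^ l ≤ (2 * y) ^ l := by gcongr; rw [two_mul]; gcongr
    _ = 2 ^ l * y ^ l := ENNReal.mul_rpow_of_nonneg _ _ hl
    _ ≤ _ := by gcongr; exact le_add_self

/-- Substitute for the triangle inequality, which fails for l < 1. One factor σ^k makes the series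
converge; the other is kept inside, and the supremum of σ^k a_k is at most its ℓ^l norm. -/
theorem tsum_geometric_mul_rpow_le (σ : ℝ≥0∞) (a : ℕ → ℝ≥0∞) {l : ℝ} (hl : 0 < l) :
    (∑' k, (σ * σ) ^ k * a k) ^ l ≤ ((1 - σ)⁻¹) ^ l * ∑' k, (σ ^ k) ^ l * a k ^ l := by
  have h1 : ∀ k, σ ^ k * a k ≤ (∑' k, (σ ^ k) ^ l * a k ^ l) ^ (1 / l) := fun k => by
    rw [one_div, ENNReal.le_rpow_inv_iff hl, ENNReal.mul_rpow_of_nonneg _ _ hl.le]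
    exact ENNReal.le_tsum (f := fun k => (σ ^ k) ^ l * a k ^ l) k
  calc (∑' k, (σ * σ) ^ k * a k) ^ l
      ≤ (∑' k, σ ^ k * (∑' k, (σ ^ k) ^ l * a k ^ l) ^ (1 / l)) ^ l := by
        refine ENNReal.rpow_le_rpow (ENNReal.tsum_le_tsum fun k => ?_) hl.le
        rw [mul_pow, mul_assoc]
        exact mul_le_mul_right (h1 k) _
    _ = _ := by
        rw [ENNReal.tsum_mul_right, ENNReal.tsum_geometric, ENNReal.mul_rpow_of_nonneg _ _ hl.le,
          ← ENNReal.rpow_mul, one_div_mul_cancel hl.ne', ENNReal.rpow_one]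

/-- A geometrically weighted sum of dyadic dilates is bounded for `mellinNorm`, for every
positive exponent. -/
theorem exists_mellinNorm_tsum_dyadic_le {σ s : ℝ≥0∞} (hσ : σ < 1) (hs : s ≠ 0) :
    ∃ C : ℝ≥0∞, C ≠ ∞ ∧ ∀ φ : ℝ → ℝ≥0∞, Measurable φ →
      mellinNorm (fun t => ∑' k : ℕ, (σ * σ) ^ k * (φ (2 ^ k * t) + φ ((2 ^ (k + 1))⁻¹ * t))) s
        ≤ C * mellinNorm φ s := by
  have hgeo : ∀ x : ℝ≥0∞, x < 1 → (1 - x)⁻¹ ≠ ∞ := fun x hx => by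
    simpa using (tsub_pos_of_lt hx).ne'
  have hσσ : σ * σ < 1 := lt_of_le_of_lt (mul_le_of_le_one_right' hσ.le) hσ
  by_cases h : s = ∞
  · refine ⟨(1 - σ * σ)⁻¹ * 2, ENNReal.mul_ne_top (hgeo _ hσσ) (by simp), fun φ _ => ?_⟩
    simp only [mellinNorm, h, if_true]
    refine iSup₂_le fun t ht => ?_
    have hle : ∀ c : ℝ, 0 < c → φ (c * t) ≤ ⨆ t ∈ Set.Ioi (0 : ℝ), φ t := fun c hc =>
      le_iSup₂ (f := fun (t : ℝ) (_ : t ∈ Set.Ioi (0 : ℝ)) => φ t) (c * t) (mul_pos hc ht)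
    calc _ ≤ ∑' k : ℕ, (σ * σ) ^ k * (2 * ⨆ t ∈ Set.Ioi (0 : ℝ), φ t) := by
          gcongr with k
          rw [two_mul]
          exact add_le_add (hle _ (by positivity)) (hle _ (by positivity))
      _ = _ := by rw [ENNReal.tsum_mul_right, ENNReal.tsum_geometric, mul_assoc]
  · set l := s.toReal with hl
    have hl0 : 0 < l := ENNReal.toReal_pos hs h
    have hσl : σ ^ l < 1 := ENNReal.rpow_lt_one hσ hl0
    refine ⟨(((1 - σ)⁻¹) ^ l * (1 - σ ^ l)⁻¹ * (2 ^ l * 2)) ^ (1 / l), ?_, fun φ hφ => ?_⟩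
    · refine ENNReal.rpow_ne_top_of_nonneg (by positivity) ?_
      refine ENNReal.mul_ne_top (ENNReal.mul_ne_top ?_ (hgeo _ hσl)) ?_
      · exact ENNReal.rpow_ne_top_of_nonneg hl0.le (hgeo _ hσ)
      · exact ENNReal.mul_ne_top (ENNReal.rpow_ne_top_of_nonneg hl0.le (by simp)) (by simp)
    simp only [mellinNorm, h, if_false, ← hl]
    rw [← ENNReal.mul_rpow_of_nonneg _ _ (by positivity)]
    refine ENNReal.rpow_le_rpow ?_ (by positivity)
    set I := ∫⁻ t in Set.Ioi (0 : ℝ), φ t ^ l / ENNReal.ofReal t with hI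
    have hdil : ∀ c : ℝ, 0 < c →
        ∫⁻ t in Set.Ioi (0 : ℝ), φ (c * t) ^ l / ENNReal.ofReal t = I := fun c hc =>
      lintegral_Ioi_comp_mul_div (fun t => φ t ^ l) hc
    calc _ ≤ ∫⁻ t in Set.Ioi (0 : ℝ), ((1 - σ)⁻¹) ^ l * ∑' k : ℕ, (σ ^ l) ^ k * (2 ^ l *
            (φ (2 ^ k * t) ^ l / ENNReal.ofReal t
              + φ ((2 ^ (k + 1))⁻¹ * t) ^ l / ENNReal.ofReal t)) := by
          refine lintegral_mono fun t => ?_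
          refine (ENNReal.div_le_div_right (tsum_geometric_mul_rpow_le σ _ hl0) _).trans ?_
          rw [mul_div_assoc, div_eq_mul_inv, ← ENNReal.tsum_mul_right]
          refine mul_le_mul_right (ENNReal.tsum_le_tsum fun k => ?_) _
          rw [← ENNReal.rpow_natCast, ← ENNReal.rpow_natCast, ← ENNReal.rpow_mul,
            ← ENNReal.rpow_mul, mul_comm (k : ℝ), ← ENNReal.add_div, div_eq_mul_inv, mul_assoc,
            ← mul_assoc ((2 : ℝ≥0∞) ^ l)]
          gcongr
          exact add_rpow_le_two_rpow_mul _ _ hl0.le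
      -- Tonelli, and then every dilate contributes the same integral I.
      _ = ((1 - σ)⁻¹) ^ l * ∑' k : ℕ, (σ ^ l) ^ k * (2 ^ l * (I + I)) := by
          rw [lintegral_const_mul _ (by fun_prop), lintegral_tsum (fun k => by fun_prop)]
          congr 2
          ext k
          rw [lintegral_const_mul _ (by fun_prop), lintegral_const_mul _ (by fun_prop),
            lintegral_add_left (by fun_prop), hdil _ (by positivity), hdil _ (by positivity)]
      _ = _ := by
          rw [ENNReal.tsum_mul_right, ENNReal.tsum_geometric, ← two_mul]
          ring

/-! ### Decreasing rearrangements -/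

theorem rearrangement_antitone {α : Type*} [MeasurableSpace α] (u : α → ℝ≥0∞) (μ : Measure α) :
    Antitone (rearrangement u μ) := fun _ _ hst =>
  sInf_le_sInf fun _ ha => ⟨ha.1, ha.2.trans hst⟩

theorem rearrangement_mono {α : Type*} [MeasurableSpace α] {u v : α → ℝ≥0∞} (h : u ≤ v)
    (μ : Measure α) : rearrangement u μ ≤ rearrangement v μ := fun _ =>
  sInf_le_sInf fun _ ha => ⟨ha.1, (measure_mono fun x hx => lt_of_lt_of_le hx (h x)).trans ha.2⟩

theorem rearrangement_congr_ae {α : Type*} [MeasurableSpace α] {u v : α → ℝ≥0∞}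
    {μ : Measure α} (h : u =ᵐ[μ] v) : rearrangement u μ = rearrangement v μ := by
  have : ∀ a, μ {x | a < u x} = μ {x | a < v x} := fun a =>
    measure_congr (by filter_upwards [h] with x hx; exact congrArg (a < ·) hx)
  funext t
  simp only [rearrangement, this]

theorem rearrangement_le_of_measure_le {α : Type*} [MeasurableSpace α] {u : α → ℝ≥0∞}
    {μ : Measure α} {a t : ℝ≥0∞} (h : μ {x | a < u x} ≤ t) : rearrangement u μ t ≤ a := by
  refine le_of_forall_gt fun b hb => ?_
  -- The infimum admits only positive levels and a may be 0, hence the passage to a larger level c.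
  obtain ⟨c, hac, hcb⟩ := exists_between hb
  exact lt_of_le_of_lt (sInf_le ⟨bot_le.trans_lt hac,
    (measure_mono fun x (hx : c < u x) => hac.trans hx).trans h⟩) hcb

/-- Along admissible levels decreasing to the infimum the superlevel sets increase, so continuity
from below passes the bound t to the limit. -/
theorem measure_rearrangement_lt_le {α : Type*} [MeasurableSpace α] (u : α → ℝ≥0∞)
    (μ : Measure α) (t : ℝ≥0∞) : μ {x | rearrangement u μ t < u x} ≤ t := by
  have hne : {a : ℝ≥0∞ | 0 < a ∧ μ {x | a < u x} ≤ t}.Nonempty := ⟨∞, by simp⟩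
  obtain ⟨a, ha, hlim, hmem⟩ := exists_seq_tendsto_sInf hne (OrderBot.bddBelow _)
  have hsub : {x | rearrangement u μ t < u x} ⊆ ⋃ n, {x | a n < u x} := fun x hx => by
    obtain ⟨n, hn⟩ := (hlim.eventually_lt_const hx).exists
    exact Set.mem_iUnion.2 ⟨n, hn⟩
  refine (measure_mono hsub).trans ?_
  have hmono : Monotone fun n => {x | a n < u x} := fun m n hmn x hx =>
    lt_of_le_of_lt (ha hmn) hx
  rw [hmono.measure_iUnion]
  exact iSup_le fun n => (hmem n).2

/-! ### Power weights and embeddings in the second index -/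

theorem measurable_powerWeighted {h : ℝ≥0∞ → ℝ≥0∞} (hh : Antitone h) (e : ℝ) :
    Measurable (powerWeighted e h) := by
  have := hh.measurable
  unfold powerWeighted
  fun_prop

/-- Antitone functions with a power weight: the supremum is controlled by every `mellinNorm`. -/
theorem powerWeighted_le_mellinNorm {h : ℝ≥0∞ → ℝ≥0∞} (hh : Antitone h) {e : ℝ} (he : 0 ≤ e)
    {s : ℝ≥0∞} (hs : s ≠ 0) {t : ℝ} (ht : 0 < t) :
    powerWeighted e h t ≤ 2 ^ (e + 1 / s.toReal) * mellinNorm (powerWeighted e h) s := by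
  by_cases hs' : s = ∞
  · simp only [mellinNorm, hs', if_true, ENNReal.toReal_top, div_zero, add_zero]
    have h1 : (1 : ℝ≥0∞) ≤ 2 ^ e := by
      simpa using ENNReal.rpow_le_rpow_of_exponent_le (x := 2) (by norm_num) he
    exact (le_iSup₂ (f := fun (t : ℝ) (_ : t ∈ Set.Ioi (0 : ℝ)) => powerWeighted e h t) t ht).trans
      (le_mul_of_one_le_left' h1)
  set l := s.toReal with hl
  have hl0 : 0 < l := ENNReal.toReal_pos hs hs'
  have hsplit : ENNReal.ofReal t = 2 * ENNReal.ofReal (t / 2) := by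
    rw [show (2 : ℝ≥0∞) = ENNReal.ofReal 2 by simp, ← ENNReal.ofReal_mul (by norm_num)]
    congr 1; ring
  have ht0 : ENNReal.ofReal (t / 2) ≠ 0 := by simpa using ht
  -- y is a lower bound for the weighted function on (t/2, t]: the power is smallest at the left
  -- end, h at the right end. Integrating against dx/x ≥ dx/t over this interval costs the factor
  -- 1/2.
  set y := ENNReal.ofReal (t / 2) ^ e * h (ENNReal.ofReal t) with hy
  have hint : 2⁻¹ * y ^ l ≤
      ∫⁻ x in Set.Ioi (0 : ℝ), powerWeighted e h x ^ l / ENNReal.ofReal x := by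
    calc 2⁻¹ * y ^ l = ∫⁻ _ in Set.Ioc (t / 2) t, y ^ l / ENNReal.ofReal t := by
          rw [setLIntegral_const, Real.volume_Ioc, show t - t / 2 = t / 2 by ring, hsplit,
            div_eq_mul_inv, ENNReal.mul_inv (by simp) (by simp), mul_assoc, mul_assoc,
            ENNReal.inv_mul_cancel ht0 ENNReal.ofReal_ne_top, mul_one, mul_comm]
      _ ≤ ∫⁻ x in Set.Ioc (t / 2) t, powerWeighted e h x ^ l / ENNReal.ofReal x := by
          refine setLIntegral_mono' measurableSet_Ioc fun x hx => ?_
          refine ENNReal.div_le_div (ENNReal.rpow_le_rpow (mul_le_mul' ?_ (hh ?_)) hl0.le) ?_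
          · exact ENNReal.rpow_le_rpow (ENNReal.ofReal_le_ofReal hx.1.le) he
          · exact ENNReal.ofReal_le_ofReal hx.2
          · exact ENNReal.ofReal_le_ofReal hx.2
      _ ≤ _ := lintegral_mono_set fun x hx => (half_pos ht).trans hx.1
  have hyl : y ≤ 2 ^ (1 / l) * mellinNorm (powerWeighted e h) s := by
    simp only [mellinNorm, hs', if_false, ← hl]
    rw [← ENNReal.mul_rpow_of_nonneg _ _ (by positivity), one_div, ENNReal.le_rpow_inv_iff hl0]
    calc y ^ l = 2 * (2⁻¹ * y ^ l) := by
          rw [← mul_assoc, ENNReal.mul_inv_cancel (by simp) (by simp), one_mul]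
      _ ≤ _ := by gcongr
  calc powerWeighted e h t = 2 ^ e * y := by
        rw [powerWeighted, hy, hsplit, ENNReal.mul_rpow_of_nonneg _ _ he, mul_assoc, ← hsplit]
    _ ≤ 2 ^ e * (2 ^ (1 / l) * mellinNorm (powerWeighted e h) s) := by gcongr
    _ = _ := by rw [← mul_assoc, ENNReal.rpow_add _ _ (by simp) (by simp)]

/-- The embedding `L^{p,l} ⊆ L^{p,s}` for `l ≤ s`. -/
theorem exists_mellinNorm_le_of_le {e : ℝ} (he : 0 ≤ e) {l s : ℝ≥0∞} (hl : l ≠ 0) (hls : l ≤ s) :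
    ∃ C : ℝ≥0∞, C ≠ ∞ ∧ ∀ h : ℝ≥0∞ → ℝ≥0∞, Antitone h →
      mellinNorm (powerWeighted e h) s ≤ C * mellinNorm (powerWeighted e h) l := by
  have hsup : ∀ h : ℝ≥0∞ → ℝ≥0∞, Antitone h → ∀ t : ℝ, 0 < t →
      powerWeighted e h t ≤ 2 ^ (e + 1 / l.toReal) * mellinNorm (powerWeighted e h) l :=
    fun h hh t ht => powerWeighted_le_mellinNorm hh he hl ht
  set A : ℝ≥0∞ := 2 ^ (e + 1 / l.toReal) with hA
  have hAt : A ≠ ∞ := ENNReal.rpow_ne_top_of_nonneg (by positivity) (by simp)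
  by_cases hs : s = ∞
  · refine ⟨A, hAt, fun h hh => ?_⟩
    conv_lhs => simp only [mellinNorm, hs, if_true]
    exact iSup₂_le fun t ht => hsup h hh t ht
  have hlt : l ≠ ∞ := ne_top_of_le_ne_top hs hls
  set b := l.toReal with hb
  set c := s.toReal with hc
  have hb0 : 0 < b := ENNReal.toReal_pos hl hlt
  have hbc : b ≤ c := ENNReal.toReal_mono hs hls
  have hc0 : 0 < c := hb0.trans_le hbc
  refine ⟨(A ^ (c - b)) ^ (1 / c), ENNReal.rpow_ne_top_of_nonneg (by positivity)
    (ENNReal.rpow_ne_top_of_nonneg (by linarith) hAt), fun h hh => ?_⟩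
  set N := mellinNorm (powerWeighted e h) l with hN
  have hNI : ∫⁻ t in Set.Ioi (0 : ℝ), powerWeighted e h t ^ b / ENNReal.ofReal t = N ^ b := by
    simp only [hN, mellinNorm, hlt, if_false, ← hb]
    rw [← ENNReal.rpow_mul, one_div_mul_cancel hb0.ne', ENNReal.rpow_one]
  have hN' : N = (N ^ c) ^ (1 / c) := by
    rw [← ENNReal.rpow_mul, mul_one_div_cancel hc0.ne', ENNReal.rpow_one]
  rw [hN', ← ENNReal.mul_rpow_of_nonneg _ _ (by positivity)]
  conv_lhs => simp only [mellinNorm, hs, if_false, ← hc]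
  refine ENNReal.rpow_le_rpow ?_ (by positivity)
  have hm := measurable_powerWeighted hh e
  -- Write φ^c = φ^(c-b) φ^b and bound the first factor by the supremum estimate A N.
  calc _ ≤ ∫⁻ t in Set.Ioi (0 : ℝ),
        (A * N) ^ (c - b) * (powerWeighted e h t ^ b / ENNReal.ofReal t) := by
        refine setLIntegral_mono' measurableSet_Ioi fun t ht => ?_
        rw [← mul_div_assoc]
        refine ENNReal.div_le_div_right ?_ _
        calc powerWeighted e h t ^ c
            = powerWeighted e h t ^ (c - b) * powerWeighted e h t ^ b := by
              rw [← ENNReal.rpow_add_of_nonneg _ _ (by linarith) hb0.le, sub_add_cancel]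
          _ ≤ _ := by
              exact mul_le_mul_left (ENNReal.rpow_le_rpow (hsup h hh t ht) (by linarith)) _
    _ = _ := by
        rw [lintegral_const_mul _ (by fun_prop), hNI,
          ENNReal.mul_rpow_of_nonneg _ _ (by linarith), mul_assoc,
          ← ENNReal.rpow_add_of_nonneg _ _ (by linarith) hb0.le, sub_add_cancel]

theorem ae_lt_top_of_mellinNorm_lt_top {α : Type*} [MeasurableSpace α] {u : α → ℝ≥0∞}
    {μ : Measure α} {e : ℝ} (he : 0 ≤ e) {s : ℝ≥0∞} (hs : s ≠ 0)
    (h : mellinNorm (powerWeighted e (rearrangement u μ)) s < ∞) : ∀ᵐ x ∂μ, u x < ∞ := by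
  -- Finiteness of the norm makes the rearrangement finite at every t > 0, so {u = ∞} lies in a
  -- superlevel set of measure at most t.
  have hle : ∀ t : ℝ≥0, 0 < t → μ {x | ¬ u x < ∞} ≤ t := fun t ht => by
    have h1 : powerWeighted e (rearrangement u μ) t < ∞ :=
      (powerWeighted_le_mellinNorm (rearrangement_antitone u μ) he hs
        (NNReal.coe_pos.2 ht)).trans_lt
        (ENNReal.mul_lt_top (ENNReal.rpow_lt_top_of_nonneg (by positivity) (by simp)) h)
    rw [powerWeighted, ENNReal.ofReal_coe_nnreal] at h1
    have h2 : rearrangement u μ t < ∞ := by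
      refine (ENNReal.lt_top_of_mul_ne_top_right h1.ne ?_)
      simp [ENNReal.rpow_eq_zero_iff, ht.ne']
    refine (measure_mono fun x hx => ?_).trans (measure_rearrangement_lt_le u μ t)
    exact h2.trans_le (not_lt.1 hx)
  rw [ae_iff]
  refine le_antisymm (ENNReal.le_of_forall_pos_le_add fun ε hε _ => ?_) bot_le
  simpa using hle ε hε

/-! ### Hölder, Young and O'Neil bounds for convolutions -/

theorem lintegral_le_lintegral_rpow_mul_measure_univ {α : Type*} [MeasurableSpace α]
    (ν : Measure α) {w : α → ℝ≥0∞} (hw : Measurable w) {r : ℝ} (hr : 1 ≤ r) :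
    ∫⁻ x, w x ∂ν ≤ (∫⁻ x, w x ^ r ∂ν) ^ (1 / r) * ν Set.univ ^ (1 - 1 / r) := by
  simpa [eLpNorm'] using eLpNorm'_le_eLpNorm'_mul_rpow_measure_univ (μ := ν) (f := w) one_pos hr
    hw.aestronglyMeasurable

section Convolution

variable {G : Type*} [AddCommGroup G] [MeasurableSpace G] [MeasurableAdd₂ G] [MeasurableNeg G]
  {μ : Measure G} [μ.IsAddLeftInvariant]

/-- Young's inequality `L¹ * L^r ⊆ L^r`. -/
theorem lintegral_conv_rpow_le [SFinite μ]
    {v w : G → ℝ≥0∞} (hv : Measurable v) (hw : Measurable w) {r : ℝ}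
    (hr : 1 ≤ r) :
    ∫⁻ x, (∫⁻ y, v y * w (x - y) ∂μ) ^ r ∂μ ≤ (∫⁻ y, v y ∂μ) ^ r * ∫⁻ y, w y ^ r ∂μ := by
  have hr0 : 0 < r := one_pos.trans_le hr
  set V := ∫⁻ y, v y ∂μ with hV
  have hpt : ∀ x, (∫⁻ y, v y * w (x - y) ∂μ) ^ r
      ≤ V ^ (r - 1) * ∫⁻ y, v y * w (x - y) ^ r ∂μ := fun x => by
    have hm : Measurable fun y => w (x - y) := hw.comp (measurable_const.sub measurable_id)
    -- Hölder for the measure v dμ, of total mass V.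
    have h1 := lintegral_le_lintegral_rpow_mul_measure_univ (μ.withDensity v) hm hr
    rw [lintegral_withDensity_eq_lintegral_mul _ hv hm,
      lintegral_withDensity_eq_lintegral_mul _ hv (hm.pow_const r), withDensity_apply _ .univ,
      setLIntegral_univ, ← hV] at h1
    refine (ENNReal.rpow_le_rpow h1 hr0.le).trans_eq ?_
    rw [ENNReal.mul_rpow_of_nonneg _ _ hr0.le, ← ENNReal.rpow_mul, ← ENNReal.rpow_mul,
      one_div_mul_cancel hr0.ne', ENNReal.rpow_one, mul_comm, sub_mul, one_div_mul_cancel hr0.ne',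
      one_mul]
    rfl
  have hm2 : Measurable fun z : G × G => v z.2 * w (z.1 - z.2) ^ r :=
    (hv.comp measurable_snd).mul ((hw.comp (measurable_fst.sub measurable_snd)).pow_const r)
  calc _ ≤ ∫⁻ x, V ^ (r - 1) * ∫⁻ y, v y * w (x - y) ^ r ∂μ ∂μ := lintegral_mono hpt
    _ = V ^ (r - 1) * ∫⁻ y, ∫⁻ x, v y * w (x - y) ^ r ∂μ ∂μ := by
        rw [lintegral_const_mul _ hm2.lintegral_prod_right', lintegral_lintegral_swap hm2.aemeasurable]
    _ = V ^ (r - 1) * (V * ∫⁻ y, w y ^ r ∂μ) := by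
        congr 1
        rw [hV, ← lintegral_mul_const _ hv]
        refine lintegral_congr fun y => ?_
        have hm : Measurable fun x => w (x - y) := hw.comp (measurable_id.sub measurable_const)
        rw [lintegral_const_mul _ (hm.pow_const r),
          lintegral_sub_right_eq_self (fun x => w x ^ r)]
    _ = _ := by
        rw [← mul_assoc]
        congr 1
        conv_lhs => rw [← ENNReal.rpow_one V, ← ENNReal.rpow_mul, mul_comm 1 (r - 1), mul_one]
        rw [← ENNReal.rpow_add_of_nonneg _ _ (by linarith) zero_le_one, sub_add_cancel]

/-- Pointwise bound for the convolution with the part of `u` below its rearrangement at `τ`. -/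
theorem lintegral_conv_low_le [μ.IsNegInvariant]
    {u w : G → ℝ≥0∞} (hu : Measurable u) (hw : Measurable w) {r : ℝ}
    (hr : 1 ≤ r) {τ : ℝ≥0∞} (hτ : τ ≠ 0) (x : G) :
    ∫⁻ y in {y | u y ≤ rearrangement u μ τ}, u y * w (x - y) ∂μ ≤
      (∑' k : ℕ, rearrangement u μ (2 ^ k * τ) * (2 ^ (k + 1) * τ) ^ (1 - 1 / r)) *
        (∫⁻ y, w y ^ r ∂μ) ^ (1 / r) := by
  have hr0 : 0 < r := one_pos.trans_le hr
  have hr1 : 0 ≤ 1 - 1 / r := by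
    rw [sub_nonneg, div_le_one hr0]; exact hr
  set h := rearrangement u μ with hh
  set W := (∫⁻ y, w y ^ r ∂μ) ^ (1 / r) with hW
  have hm : Measurable fun y => w (x - y) := hw.comp (measurable_const.sub measurable_id)
  have hWx : ∫⁻ y, w (x - y) ^ r ∂μ = ∫⁻ y, w y ^ r ∂μ :=
    lintegral_sub_left_eq_self (fun y => w y ^ r) x
  set A : ℕ → Set G := fun k => {y | h (2 ^ (k + 1) * τ) < u y ∧ u y ≤ h (2 ^ k * τ)} with hA
  have hAm : ∀ k, MeasurableSet (A k) := fun k =>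
    (measurableSet_lt measurable_const hu).inter (measurableSet_le hu measurable_const)
  set Z : Set G := {y | ∀ k : ℕ, u y ≤ h (2 ^ k * τ)} with hZ
  have hcover : {y | u y ≤ h τ} ⊆ Z ∪ ⋃ k, A k := fun y hy => by
    by_contra hc
    simp only [Set.mem_union, Set.mem_iUnion, not_or, not_exists] at hc
    refine hc.1 fun k => ?_
    induction k with
    | zero => simpa using hy
    | succ k ih => exact not_lt.1 fun hlt => hc.2 k ⟨hlt, ih⟩
  -- Z is the part below every layer. If u is nonzero somewhere on Z, the values h(2^k τ) stay above
  -- a positive constant and the series diverges; a finite right side then forces W = 0, so w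
  -- vanishes a.e.
  have hZ0 : (∑' k : ℕ, h (2 ^ k * τ) * (2 ^ (k + 1) * τ) ^ (1 - 1 / r)) * W ≠ ∞ →
      ∫⁻ y in Z, u y * w (x - y) ∂μ = 0 := fun hfin => by
    have hZm : MeasurableSet Z := by
      rw [hZ, Set.ofPred_forall]
      exact MeasurableSet.iInter fun k => measurableSet_le hu measurable_const
    by_cases hz : ∀ y ∈ Z, u y = 0
    · rw [setLIntegral_congr_fun (g := fun _ => 0) hZm fun y hy => by simp [hz y hy]]
      simp
    · push Not at hz
      obtain ⟨y, hy, hy0⟩ := hz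
      have hsum : (∑' k : ℕ, h (2 ^ k * τ) * (2 ^ (k + 1) * τ) ^ (1 - 1 / r)) = ∞ := by
        have hne : u y * min 1 (τ ^ (1 - 1 / r)) ≠ 0 := by
          refine mul_ne_zero hy0 (ne_of_gt (lt_min one_pos ?_))
          rw [pos_iff_ne_zero]
          intro h0
          rcases ENNReal.rpow_eq_zero_iff.1 h0 with h1 | h1
          · exact hτ h1.1
          · exact absurd h1.2 (not_lt.2 hr1)
        rw [eq_top_iff, ← ENNReal.tsum_const_eq_top_of_ne_zero (α := ℕ) hne]
        refine ENNReal.tsum_le_tsum fun k => mul_le_mul' (hy k) ((min_le_right _ _).trans ?_)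
        refine ENNReal.rpow_le_rpow (le_mul_of_one_le_left' ?_) hr1
        exact one_le_pow₀ (by norm_num)
      have hW0 : W = 0 := by
        by_contra hne
        exact hfin (by rw [hsum, ENNReal.top_mul hne])
      have hint : ∫⁻ y, w (x - y) ^ r ∂μ = 0 := by
        rw [hWx]
        simpa [hW, ENNReal.rpow_eq_zero_iff, hr0, hr0.not_gt] using hW0
      rw [lintegral_eq_zero_iff (hm.pow_const r)] at hint
      refine le_antisymm ((setLIntegral_le_lintegral _ _).trans_eq ?_) bot_le
      refine lintegral_eq_zero_of_ae_eq_zero ?_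
      filter_upwards [hint] with z hz
      have : w (x - z) = 0 := by
        simpa [ENNReal.rpow_eq_zero_iff, hr0, hr0.not_gt] using hz
      simp [this]
  by_cases hfin : (∑' k : ℕ, h (2 ^ k * τ) * (2 ^ (k + 1) * τ) ^ (1 - 1 / r)) * W = ∞
  · rw [hfin]; exact le_top
  calc _ ≤ ∫⁻ y in Z ∪ ⋃ k, A k, u y * w (x - y) ∂μ := lintegral_mono_set hcover
    _ ≤ ∫⁻ y in Z, u y * w (x - y) ∂μ + ∫⁻ y in ⋃ k, A k, u y * w (x - y) ∂μ :=
        lintegral_union_le _ _ _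
    _ ≤ 0 + ∑' k, ∫⁻ y in A k, u y * w (x - y) ∂μ :=
        add_le_add (hZ0 hfin).le (lintegral_iUnion_le _ _)
    _ ≤ ∑' k, h (2 ^ k * τ) * (2 ^ (k + 1) * τ) ^ (1 - 1 / r) * W := by
        rw [zero_add]
        refine ENNReal.tsum_le_tsum fun k => ?_
        calc ∫⁻ y in A k, u y * w (x - y) ∂μ
            ≤ ∫⁻ y in A k, h (2 ^ k * τ) * w (x - y) ∂μ :=
              setLIntegral_mono' (hAm k) fun y hy => mul_le_mul_left hy.2 _
          _ = h (2 ^ k * τ) * ∫⁻ y in A k, w (x - y) ∂μ := lintegral_const_mul _ hm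
          _ ≤ h (2 ^ k * τ) * ((∫⁻ y in A k, w (x - y) ^ r ∂μ) ^ (1 / r) *
                (μ.restrict (A k) Set.univ) ^ (1 - 1 / r)) :=
              mul_le_mul_right (lintegral_le_lintegral_rpow_mul_measure_univ _ hm hr) _
          _ ≤ h (2 ^ k * τ) * (W * (2 ^ (k + 1) * τ) ^ (1 - 1 / r)) := by
              refine mul_le_mul_right (mul_le_mul' ?_ ?_) _
              · rw [hW, ← hWx]
                exact ENNReal.rpow_le_rpow (setLIntegral_le_lintegral _ _) (by positivity)
              · rw [Measure.restrict_apply_univ]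
                exact ENNReal.rpow_le_rpow ((measure_mono fun y hy => hy.1).trans
                  (measure_rearrangement_lt_le u μ _)) hr1
          _ = _ := by rw [mul_comm W, mul_assoc]
    _ = _ := ENNReal.tsum_mul_right

/-- Layers towards small scales: u is at most h(2^(-k-1) τ) on the k-th one, whose measure is at
most 2^(-k) τ. What lies above all layers is null because 2^(-k) τ → 0, which needs τ finite. -/
theorem lintegral_high_le {α : Type*} [MeasurableSpace α] {μ : Measure α} {u : α → ℝ≥0∞}
    (hu : Measurable u) {τ : ℝ≥0∞} (hτ : τ ≠ ∞) :
    ∫⁻ y in {y | rearrangement u μ τ < u y}, u y ∂μ ≤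
      ∑' k : ℕ, rearrangement u μ ((2 ^ (k + 1))⁻¹ * τ) * ((2 ^ k)⁻¹ * τ) := by
  set h := rearrangement u μ with hh
  set A : ℕ → Set α := fun k =>
    {y | h ((2 ^ k)⁻¹ * τ) < u y ∧ u y ≤ h ((2 ^ (k + 1))⁻¹ * τ)} with hA
  have hAm : ∀ k, MeasurableSet (A k) := fun k =>
    (measurableSet_lt measurable_const hu).inter (measurableSet_le hu measurable_const)
  set Z : Set α := {y | ∀ k : ℕ, h ((2 ^ k)⁻¹ * τ) < u y} with hZ
  have hcover : {y | h τ < u y} ⊆ Z ∪ ⋃ k, A k := fun y hy => by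
    by_contra hc
    simp only [Set.mem_union, Set.mem_iUnion, not_or, not_exists] at hc
    refine hc.1 fun k => ?_
    induction k with
    | zero => simpa using hy
    | succ k ih => exact not_le.1 fun hle => hc.2 k ⟨ih, hle⟩
  have hZ0 : μ Z = 0 := by
    have hlim : Filter.Tendsto (fun k : ℕ => ((2 : ℝ≥0∞) ^ k)⁻¹ * τ) Filter.atTop (nhds 0) := by
      have := ENNReal.Tendsto.mul_const (b := τ)
        (ENNReal.tendsto_pow_atTop_nhds_zero_of_lt_one (r := 2⁻¹) (by norm_num)) (Or.inr hτ)
      simpa [ENNReal.inv_pow] using this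
    exact le_antisymm (ge_of_tendsto' hlim fun k =>
      (measure_mono fun y (hy : y ∈ Z) => hy k).trans (measure_rearrangement_lt_le u μ _)) bot_le
  calc _ ≤ ∫⁻ y in Z ∪ ⋃ k, A k, u y ∂μ := lintegral_mono_set hcover
    _ ≤ ∫⁻ y in Z, u y ∂μ + ∫⁻ y in ⋃ k, A k, u y ∂μ := lintegral_union_le _ _ _
    _ ≤ 0 + ∑' k, ∫⁻ y in A k, u y ∂μ :=
        add_le_add (setLIntegral_measure_zero _ _ hZ0).le (lintegral_iUnion_le _ _)
    _ ≤ _ := by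
        rw [zero_add]
        refine ENNReal.tsum_le_tsum fun k => ?_
        calc ∫⁻ y in A k, u y ∂μ
            ≤ ∫⁻ _ in A k, h ((2 ^ (k + 1))⁻¹ * τ) ∂μ :=
              setLIntegral_mono' (hAm k) fun y hy => hy.2
          _ = h ((2 ^ (k + 1))⁻¹ * τ) * μ (A k) := setLIntegral_const _ _
          _ ≤ _ := mul_le_mul_right ((measure_mono fun y hy => hy.1).trans
                (measure_rearrangement_lt_le u μ _)) _

/-- A dyadic form of O'Neil's inequality for the rearrangement of a convolution. -/
theorem rearrangement_conv_le [SFinite μ] [μ.IsNegInvariant]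
    {u w : G → ℝ≥0∞} (hu : Measurable u) (hw : Measurable w) {r : ℝ}
    (hr : 1 ≤ r) {τ : ℝ≥0∞} (hτ : τ ≠ 0) (hτ' : τ ≠ ∞) :
    rearrangement (fun x => ∫⁻ y, u y * w (x - y) ∂μ) μ τ ≤
      (∫⁻ y, w y ^ r ∂μ) ^ (1 / r) * ∑' k : ℕ,
        (rearrangement u μ (2 ^ k * τ) * (2 ^ (k + 1) * τ) ^ (1 - 1 / r) +
          rearrangement u μ ((2 ^ (k + 1))⁻¹ * τ) * ((2 ^ k)⁻¹ * τ) * τ ^ (-(1 / r))) := by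
  have hr0 : 0 < r := one_pos.trans_le hr
  set h := rearrangement u μ with hh
  set W := (∫⁻ y, w y ^ r ∂μ) ^ (1 / r) with hW
  set L := ∑' k : ℕ, h (2 ^ k * τ) * (2 ^ (k + 1) * τ) ^ (1 - 1 / r) with hL
  set D := ∑' k : ℕ, h ((2 ^ (k + 1))⁻¹ * τ) * ((2 ^ k)⁻¹ * τ) with hD
  rw [ENNReal.tsum_add, ENNReal.tsum_mul_right, ← hL, ← hD, mul_add]
  have hS : MeasurableSet {y | h τ < u y} := measurableSet_lt measurable_const hu
  set v := Set.indicator {y | h τ < u y} u with hv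
  have hvm : Measurable v := hu.indicator hS
  set F : G → ℝ≥0∞ := fun x => ∫⁻ y, v y * w (x - y) ∂μ with hF
  have hFm : Measurable F := by
    have hm2 : Measurable fun z : G × G => v z.2 * w (z.1 - z.2) :=
      (hvm.comp measurable_snd).mul (hw.comp (measurable_fst.sub measurable_snd))
    exact hm2.lintegral_prod_right'
  have hsplit : ∀ x, ∫⁻ y, u y * w (x - y) ∂μ ≤ W * L + F x := fun x => by
    rw [← lintegral_add_compl _ hS, add_comm]
    refine add_le_add ?_ ?_
    · rw [mul_comm W, Set.compl_ofPred]
      simp only [not_lt]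
      exact lintegral_conv_low_le hu hw hr hτ x
    · rw [← lintegral_indicator hS]
      refine (lintegral_congr fun y => ?_).le
      by_cases hy : y ∈ {y | h τ < u y} <;> simp only [hv, Set.indicator_of_mem, hy,
        Set.indicator_of_notMem, not_false_eq_true, zero_mul]
  have hFr : ∫⁻ x, F x ^ r ∂μ ≤ (D * W) ^ r := by
    refine (lintegral_conv_rpow_le hvm hw hr).trans ?_
    rw [ENNReal.mul_rpow_of_nonneg _ _ hr0.le, hW, ← ENNReal.rpow_mul, one_div_mul_cancel hr0.ne',
      ENNReal.rpow_one]
    refine mul_le_mul_left (ENNReal.rpow_le_rpow ?_ hr0.le) _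
    rw [hv, lintegral_indicator hS]
    exact lintegral_high_le hu hτ'
  refine rearrangement_le_of_measure_le ?_
  refine (measure_mono (t := {x | W * (D * τ ^ (-(1 / r))) < F x}) fun x hx => ?_).trans ?_
  · by_contra hc
    exact absurd (lt_of_lt_of_le hx (hsplit x)) (not_lt.2 (by gcongr; exact not_lt.1 hc))
  rw [show W * (D * τ ^ (-(1 / r))) = D * W * τ ^ (-(1 / r)) by ring]
  have hτr : τ ^ (-(1 / r)) ≠ 0 ∧ τ ^ (-(1 / r)) ≠ ∞ := by
    simp [ENNReal.rpow_eq_zero_iff, ENNReal.rpow_eq_top_iff, hτ, hτ']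
  -- Chebyshev needs D W positive and finite. If it is 0, F vanishes a.e.; if it is ∞, the threshold
  -- is infinite and nothing exceeds it.
  by_cases h0 : D * W = 0
  · have : ∫⁻ x, F x ^ r ∂μ = 0 := by
      refine le_antisymm (hFr.trans_eq ?_) bot_le
      rw [h0, ENNReal.zero_rpow_of_pos hr0]
    rw [lintegral_eq_zero_iff (hFm.pow_const r)] at this
    have hz : μ {x | D * W * τ ^ (-(1 / r)) < F x} = 0 := by
      refine measure_mono_null (fun x hx => ?_) (ae_iff.1 this)
      simp only [Set.mem_ofPred_eq, h0, zero_mul] at hx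
      simp [ENNReal.rpow_eq_zero_iff, hx.ne', hr0.not_gt]
    rw [hz]; exact bot_le
  by_cases ht : D * W = ∞
  · rw [ht, ENNReal.top_mul hτr.1]
    simp
  -- The factor τ^(-1/r) in the threshold is chosen so that Chebyshev for F^r returns exactly τ.
  have hpow : (D * W * τ ^ (-(1 / r))) ^ r = (D * W) ^ r / τ := by
    rw [ENNReal.mul_rpow_of_nonneg _ _ hr0.le, ← ENNReal.rpow_mul, neg_mul,
      one_div_mul_cancel hr0.ne', ENNReal.rpow_neg_one, div_eq_mul_inv]
  have hcheb := mul_meas_ge_le_lintegral₀ (μ := μ) (hFm.pow_const r).aemeasurable ((D * W) ^ r / τ)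
  have hX0 : (D * W) ^ r ≠ 0 := by simp [ENNReal.rpow_eq_zero_iff, h0, ht]
  have hXt : (D * W) ^ r ≠ ∞ := ENNReal.rpow_ne_top_of_nonneg hr0.le ht
  have hle : (D * W) ^ r / τ * μ {x | D * W * τ ^ (-(1 / r)) < F x} ≤ (D * W) ^ r := by
    refine (mul_le_mul_right (measure_mono fun x hx => ?_) _).trans (hcheb.trans hFr)
    rw [Set.mem_ofPred_eq, ← hpow]
    exact ENNReal.rpow_le_rpow (le_of_lt hx) hr0.le
  calc _ = (τ / (D * W) ^ r) * ((D * W) ^ r / τ * μ {x | D * W * τ ^ (-(1 / r)) < F x}) := by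
        rw [← mul_assoc, ← mul_div_assoc, ENNReal.div_mul_cancel hX0 hXt,
          ENNReal.div_self hτ hτ', one_mul]
    _ ≤ τ / (D * W) ^ r * (D * W) ^ r := mul_le_mul_right hle _
    _ = τ := ENNReal.div_mul_cancel hX0 hXt

/-- By b = a + 1 - 1/r the powers of τ match. The dyadic factors left over are 2^(1-1/r) 2^(-ka) and
2^b 2^(-k(1-b)); both are at most 2 · 2^(-δk). -/
theorem powerWeighted_rearrangement_conv_le [SFinite μ] [μ.IsNegInvariant]
    {u w : G → ℝ≥0∞} (hu : Measurable u)
    (hw : Measurable w) {r a b δ : ℝ} (hr : 1 ≤ r) (hδ0 : 0 ≤ δ) (hb1 : b ≤ 1 - δ) (ha : δ ≤ a)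
    (hab : b = a + 1 - 1 / r) {t : ℝ} (ht : 0 < t) :
    powerWeighted a (rearrangement (fun x => ∫⁻ y, u y * w (x - y) ∂μ) μ) t ≤
      (2 * (∫⁻ y, w y ^ r ∂μ) ^ (1 / r)) * ∑' k : ℕ, ((2 : ℝ≥0∞) ^ (-δ)) ^ k *
        (powerWeighted b (rearrangement u μ) (2 ^ k * t) +
          powerWeighted b (rearrangement u μ) ((2 ^ (k + 1))⁻¹ * t)) := by
  have hr0 : 0 < 1 / r := by positivity
  set τ := ENNReal.ofReal t with hτ
  have hτ0 : τ ≠ 0 := by simpa [hτ] using ht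
  have hτt : τ ≠ ∞ := ENNReal.ofReal_ne_top
  have h2 : ∀ k : ℕ, ENNReal.ofReal (2 ^ k * t) = 2 ^ k * τ := fun k => by
    rw [ENNReal.ofReal_mul (by positivity), ENNReal.ofReal_pow (by norm_num), ENNReal.ofReal_ofNat]
  have h2' : ∀ k : ℕ, ENNReal.ofReal ((2 ^ k)⁻¹ * t) = (2 ^ k)⁻¹ * τ := fun k => by
    rw [ENNReal.ofReal_mul (by positivity), ENNReal.ofReal_inv_of_pos (by positivity),
      ENNReal.ofReal_pow (by norm_num), ENNReal.ofReal_ofNat]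
  have hpow : ∀ (k : ℕ) (c : ℝ), ((2 : ℝ≥0∞) ^ k * τ) ^ c = 2 ^ (k * c) * τ ^ c := fun k c => by
    rw [ENNReal.mul_rpow_of_ne_zero (by simp) hτ0, ← ENNReal.rpow_natCast, ← ENNReal.rpow_mul]
  have hpow' : ∀ (k : ℕ) (c : ℝ), (((2 : ℝ≥0∞) ^ k)⁻¹ * τ) ^ c = 2 ^ (-(k * c)) * τ ^ c :=
    fun k c => by
    rw [ENNReal.mul_rpow_of_ne_zero (by simp) hτ0, ← ENNReal.rpow_natCast, ← ENNReal.rpow_neg,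
      ← ENNReal.rpow_mul, neg_mul]
  have hadd : ∀ c d : ℝ, (2 : ℝ≥0∞) ^ (c + d) = 2 ^ c * 2 ^ d := fun c d =>
    ENNReal.rpow_add _ _ (by simp) (by simp)
  have hle : ∀ c d : ℝ, c ≤ d → (2 : ℝ≥0∞) ^ c ≤ 2 ^ d := fun c d hcd =>
    ENNReal.rpow_le_rpow_of_exponent_le (by norm_num) hcd
  have hδ : ∀ k : ℕ, ((2 : ℝ≥0∞) ^ (-δ)) ^ k = 2 ^ (-(δ * k)) := fun k => by
    rw [← ENNReal.rpow_natCast, ← ENNReal.rpow_mul, neg_mul]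
  set h := rearrangement u μ with hh
  set W := (∫⁻ y, w y ^ r ∂μ) ^ (1 / r) with hW
  calc _ ≤ τ ^ a * (W * _) := mul_le_mul_right (rearrangement_conv_le hu hw hr hτ0 hτt) _
    _ = W * ∑' k : ℕ, τ ^ a * (h (2 ^ k * τ) * (2 ^ (k + 1) * τ) ^ (1 - 1 / r) +
          h ((2 ^ (k + 1))⁻¹ * τ) * ((2 ^ k)⁻¹ * τ) * τ ^ (-(1 / r))) := by
        rw [ENNReal.tsum_mul_left]; ring
    _ ≤ W * ∑' k : ℕ, 2 * (((2 : ℝ≥0∞) ^ (-δ)) ^ k *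
        (powerWeighted b h (2 ^ k * t) + powerWeighted b h ((2 ^ (k + 1))⁻¹ * t))) := by
        refine mul_le_mul_right (ENNReal.tsum_le_tsum fun k => ?_) _
        rw [mul_add, mul_add (_ ^ k), mul_add 2]
        have hk : (0 : ℝ) ≤ k := k.cast_nonneg
        refine add_le_add ?_ ?_
        · rw [powerWeighted, h2, hpow, hpow, hδ]
          calc τ ^ a * (h (2 ^ k * τ) * (2 ^ (((k + 1 : ℕ) : ℝ) * (1 - 1 / r)) * τ ^ (1 - 1 / r)))
              = 2 ^ (((k + 1 : ℕ) : ℝ) * (1 - 1 / r)) * (τ ^ b * h (2 ^ k * τ)) := by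
                rw [hab, add_sub_assoc, ENNReal.rpow_add _ _ hτ0 hτt]; ring
            _ ≤ 2 ^ (1 + (-(δ * k) + k * b)) * (τ ^ b * h (2 ^ k * τ)) := by
                refine mul_le_mul_left (hle _ _ ?_) _
                push_cast
                nlinarith [mul_le_mul_of_nonneg_left ha hk]
            _ = _ := by rw [hadd, hadd, ENNReal.rpow_one]; ring
        · rw [powerWeighted, h2', hpow', hδ]
          have hk2 : ((2 : ℝ≥0∞) ^ k)⁻¹ = 2 ^ (-(k : ℝ)) := by
            rw [ENNReal.rpow_neg, ENNReal.rpow_natCast]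
          calc τ ^ a * (h ((2 ^ (k + 1))⁻¹ * τ) * ((2 ^ k)⁻¹ * τ) * τ ^ (-(1 / r)))
              = 2 ^ (-(k : ℝ)) * (τ ^ b * h ((2 ^ (k + 1))⁻¹ * τ)) := by
                rw [hab, sub_eq_add_neg, ENNReal.rpow_add _ _ hτ0 hτt,
                  ENNReal.rpow_add _ _ hτ0 hτt, ENNReal.rpow_one, hk2]; ring
            _ ≤ 2 ^ (1 + (-(δ * k) + -(((k + 1 : ℕ) : ℝ) * b))) *
                  (τ ^ b * h ((2 ^ (k + 1))⁻¹ * τ)) := by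
                refine mul_le_mul_left (hle _ _ ?_) _
                push_cast
                nlinarith [mul_le_mul_of_nonneg_left hb1 hk]
            _ = _ := by rw [hadd, hadd, ENNReal.rpow_one]; ring
    _ = _ := by rw [ENNReal.tsum_mul_left]; ring

end Convolution

/-! ### The norm inequality and its Lorentz space form -/

theorem exists_mellinNorm_rearrangement_conv_le {r a b : ℝ} {l s : ℝ≥0∞} (hr : 1 ≤ r)
    (ha : 0 < a) (hb1 : b < 1) (hab : b = a + 1 - 1 / r) (hl : l ≠ 0) (hls : l ≤ s) :
    ∃ C : ℝ≥0∞, C ≠ ∞ ∧ ∀ {G : Type*} [AddCommGroup G] [MeasurableSpace G] [MeasurableAdd₂ G]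
      [MeasurableNeg G] {μ : Measure G} [SFinite μ] [μ.IsAddLeftInvariant] [μ.IsNegInvariant]
      {u w : G → ℝ≥0∞}, Measurable u → Measurable w →
      mellinNorm (powerWeighted a (rearrangement (fun x => ∫⁻ y, u y * w (x - y) ∂μ) μ)) s ≤
        C * mellinNorm (powerWeighted b (rearrangement u μ)) l *
          (∫⁻ y, w y ^ r ∂μ) ^ (1 / r) := by
  set δ := min a (1 - b) with hδ
  have hδ0 : 0 < δ := lt_min ha (by linarith)
  -- Half of the decay rate δ, since the dyadic sum is weighted by (σ * σ)^k.
  set σ : ℝ≥0∞ := 2 ^ (-(δ / 2)) with hσ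
  have hσ1 : σ < 1 := ENNReal.rpow_lt_one_of_one_lt_of_neg (by norm_num) (by linarith)
  have hσσ : σ * σ = 2 ^ (-δ) := by
    rw [hσ, ← ENNReal.rpow_add _ _ (by simp) (by simp)]
    congr 1; ring
  obtain ⟨A, hA, hA'⟩ := exists_mellinNorm_tsum_dyadic_le hσ1 hl
  obtain ⟨B, hB, hB'⟩ := exists_mellinNorm_le_of_le ha.le hl hls
  refine ⟨B * (2 * A), ENNReal.mul_ne_top hB (ENNReal.mul_ne_top (by simp) hA), ?_⟩
  intro G _ _ _ _ μ _ _ _ u w hu hw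
  set W := (∫⁻ y, w y ^ r ∂μ) ^ (1 / r)
  set φ := powerWeighted b (rearrangement u μ)
  have hφ : Measurable φ := measurable_powerWeighted (rearrangement_antitone u μ) b
  calc _ ≤ B * mellinNorm
        (powerWeighted a (rearrangement (fun x => ∫⁻ y, u y * w (x - y) ∂μ) μ)) l :=
        hB' _ (rearrangement_antitone _ μ)
    _ ≤ B * mellinNorm (fun t => (2 * W) * ∑' k : ℕ, (σ * σ) ^ k *
          (φ (2 ^ k * t) + φ ((2 ^ (k + 1))⁻¹ * t))) l := by
        refine mul_le_mul_right (mellinNorm_mono (fun t ht => ?_) l) _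
        rw [hσσ]
        exact powerWeighted_rearrangement_conv_le hu hw hr hδ0.le
          (by linarith [min_le_right a (1 - b)]) (min_le_left _ _) hab ht
    _ = B * ((2 * W) * mellinNorm (fun t => ∑' k : ℕ, (σ * σ) ^ k *
          (φ (2 ^ k * t) + φ ((2 ^ (k + 1))⁻¹ * t))) l) := by
        rw [mellinNorm_const_mul (by fun_prop) _ hl]
    _ ≤ B * ((2 * W) * (A * mellinNorm φ l)) := by gcongr; exact hA' φ hφ
    _ = _ := by ring

theorem lemma2p2 (p q r s l : ℝ≥0∞) (hl : 0 < l) (hls : l ≤ s)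
    (hr₁ : 1 ≤ r) (hr : r < ∞) (hp₁ : 1 < p) (hp : p < ∞) (hq₁ : 1 < q) (hq : q < ∞)
    (hpqr : 1 / p + 1 = 1 / q + 1 / r) :
    ∃ C : ℝ≥0, 0 < C ∧
      ∀ (n : ℕ) (𝕜 : Type*) [RCLike 𝕜] (f g : EuclideanSpace ℝ (Fin n) → 𝕜),
        MemLorentz f q l volume → MemLp g r volume →
          (∀ᵐ x, ConvolutionExistsAt f g x (ContinuousLinearMap.mul 𝕜 𝕜) volume) ∧
          MemLorentz (f ⋆[ContinuousLinearMap.mul 𝕜 𝕜, volume] g) p s volume ∧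
          lorentzNorm (f ⋆[ContinuousLinearMap.mul 𝕜 𝕜, volume] g) p s volume
            ≤ C * lorentzNorm f q l volume * eLpNorm g r volume := by
  have hp0 : p ≠ 0 := (one_pos.trans hp₁).ne'
  have hq0 : q ≠ 0 := (one_pos.trans hq₁).ne'
  have hr0 : r ≠ 0 := (one_pos.trans_le hr₁).ne'
  have hR1 : 1 ≤ r.toReal := by simpa using ENNReal.toReal_mono hr.ne hr₁
  have ha : 0 < (p⁻¹).toReal :=
    ENNReal.toReal_pos (ENNReal.inv_ne_zero.2 hp.ne) (ENNReal.inv_ne_top.2 hp0)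
  have hb : (q⁻¹).toReal < 1 := by
    have h := (ENNReal.toReal_lt_toReal (ENNReal.inv_ne_top.2 hq0) ENNReal.one_ne_top).2
      (ENNReal.inv_lt_one.2 hq₁)
    simpa using h
  have hab : (q⁻¹).toReal = (p⁻¹).toReal + 1 - 1 / r.toReal := by
    have h := congrArg ENNReal.toReal hpqr
    simp only [one_div] at h
    rw [ENNReal.toReal_add (ENNReal.inv_ne_top.2 hp0) ENNReal.one_ne_top,
      ENNReal.toReal_add (ENNReal.inv_ne_top.2 hq0) (ENNReal.inv_ne_top.2 hr0),
      ENNReal.toReal_one, ENNReal.toReal_inv r] at h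
    rw [one_div]
    linarith
  obtain ⟨C, hC, hbound⟩ := exists_mellinNorm_rearrangement_conv_le hR1 ha hb hab hl.ne' hls
  -- C may be 0; adding 1 makes the constant positive.
  refine ⟨C.toNNReal + 1, by positivity, fun n 𝕜 _ f g hf hg => ?_⟩
  set u := hf.1.enorm.mk _
  set w := hg.1.enorm.mk _
  have hum : Measurable u := hf.1.enorm.measurable_mk
  have hwm : Measurable w := hg.1.enorm.measurable_mk
  have hfu : (fun x => ‖f x‖ₑ) =ᵐ[volume] u := hf.1.enorm.ae_eq_mk
  have hgw : (fun x => ‖g x‖ₑ) =ᵐ[volume] w := hg.1.enorm.ae_eq_mk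
  -- Valid for every x, since y ↦ x - y pulls null sets back to null sets.
  have hconv : ∀ x, ∫⁻ y, ‖f y * g (x - y)‖ₑ = ∫⁻ y, u y * w (x - y) := fun x => by
    refine lintegral_congr_ae ?_
    filter_upwards [hfu, (quasiMeasurePreserving_sub_left_of_right_invariant volume x).ae hgw]
      with y h1 h2
    rw [enorm_mul, h1, h2]
  have hfnorm : mellinNorm (powerWeighted (q⁻¹).toReal (rearrangement u volume)) l
      = lorentzNorm f q l volume := by
    rw [lorentzNorm_eq_mellinNorm, rearrangement_congr_ae hfu]
  have hgnorm : (∫⁻ y, w y ^ r.toReal) ^ (1 / r.toReal) = eLpNorm g r volume := by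
    rw [eLpNorm_eq_lintegral_rpow_enorm_toReal hr0 hr.ne]
    congr 1
    refine lintegral_congr_ae ?_
    filter_upwards [hgw] with y h1
    rw [h1]
  have hmain := hbound (μ := (volume : Measure (EuclideanSpace ℝ (Fin n)))) hum hwm
  rw [hfnorm, hgnorm] at hmain
  have hfin : C * lorentzNorm f q l volume * eLpNorm g r volume < ∞ :=
    ENNReal.mul_lt_top (ENNReal.mul_lt_top hC.lt_top hf.2) hg.2
  have hle : lorentzNorm (f ⋆[ContinuousLinearMap.mul 𝕜 𝕜, volume] g) p s volume
      ≤ C * lorentzNorm f q l volume * eLpNorm g r volume := by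
    refine le_trans ?_ hmain
    rw [lorentzNorm_eq_mellinNorm]
    refine mellinNorm_mono (fun t _ => mul_le_mul_right (rearrangement_mono (fun x => ?_) _ _) _) s
    rw [← hconv]
    -- This holds even where the integral diverges: the convolution then has the default value 0.
    exact enorm_integral_le_lintegral_enorm _
  refine ⟨?_, ⟨?_, hle.trans_lt hfin⟩, hle.trans ?_⟩
  -- Absolute convergence a.e. follows from the bound itself: the norm of |f| * |g| is finite, so
  -- |f| * |g| is finite a.e.
  · filter_upwards [ae_lt_top_of_mellinNorm_lt_top ha.le (hl.trans_le hls).ne'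
      (hmain.trans_lt hfin)] with x hx
    refine ⟨hf.1.convolution_integrand_snd (ContinuousLinearMap.mul 𝕜 𝕜) hg.1 x, ?_⟩
    rw [hasFiniteIntegral_iff_enorm]
    exact (hconv x).trans_lt hx
  · exact (hf.1.convolution_integrand (ContinuousLinearMap.mul 𝕜 𝕜) hg.1).integral_prod_right'
  · gcongr
    rw [ENNReal.coe_add, ENNReal.coe_toNNReal hC]
    exact le_self_add
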